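/- Let $F_0=0$, $F_1=1$, $F_m(x)=xF_{m-1}(x)+F_{m-2}(x)$ be the Fibonacci polynomials, regarded as maps $\mathbb{Z}_2\to\mathbb{Z}_2$. For an integer $q\ge 0$ with binary expansion $q=\sum_{i\ge0}c_i2^i$ (so $c_i\in\{0,1\}$, with $c_i=0$ for large $i$), let $t(q)=\min\{i\ge 0: c_i=c_{i+1}\}$. For $f:\mathbb{Z}_p\to\mathbb{Z}_p$, a minimal component is a nonempty clopen set $S$ with $f(S)\subseteq S$ that is a finite union of balls and such that the orbit of every $x\in S$ is dense in $S$. The attracting basin of a set $A$ is the set of $x$ with $\operatorname{dist}(f^n(x),A)\to0$ as $n\to\infty$. A decomposition $\mathbb{Z}_p=\mathcal P\sqcup\bigsqcup_i\mathcal M_i\sqcup\mathcal B$ is the minimal decomposition for $f$ if $\mathcal P$ is the set of all periodic points of $f$ and is finite, the $\mathcal M_i$ are pairwise disjoint, at most countably many, and are exactly all the minimal components of $f$, and every point of $\mathcal B$ lies in the attracting basin of a periodic orbit or of some $\mathcal M_i$. Theorem. Let $m=6+12q$ with $q$ odd and let $t=t(q)$. Then the minimal decomposition of $\mathbb{Z}_2$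 for $F_m$ is $$\mathbb{Z}_2=\{0\}\sqcup\Bigl(\bigsqcup_{n\ge1}\bigsqcup_{k=0}^{2^{t+1}-1}M_{n,k}\Bigr)\sqcup(1+2\mathbb{Z}_2),\qquad M_{n,k}=(1+2k)2^n+2^{n+t+2}\mathbb{Z}_2 .$$ Here $0$ is a fixed point of $F_m$, the set $\{0\}$ consists of all periodic points, and the $M_{n,k}$ are the minimal components. The clopen set $1+2\mathbb{Z}_2$ is the attracting basin of $\{0\}$ and the $M_{n,k}$, that is, it is the set of all points outside $\{0\}\cup\bigcup_{n,k}M_{n,k}$ that lie in the attracting basin of $\{0\}$ or of some $M_{n,k}$. -/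

import Mathlib

open Polynomial Filter Topology Set Function

/-- The Fibonacci polynomials: `F₀ = 0`, `F₁ = 1`, `F_m = X * F_{m-1} + F_{m-2}`. -/
noncomputable def fibPoly (R : Type*) [CommRing R] : ℕ → R[X]
  | 0 => 0
  | 1 => 1
  | m + 2 => X * fibPoly R (m + 1) + fibPoly R m

/-- For `q = c₀ + c₁ 2 + c₂ 2² + ⋯` (binary digits), the least `i ≥ 0` with `c_i = c_{i+1}`.
The set is never empty because all large digits are `0`. -/
noncomputable def digitRepeat (q : ℕ) : ℕ :=
  sInf {i : ℕ | q.testBit i = q.testBit (i + 1)}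

/-- The ball `a + p ^ n ℤ_p`. -/
def padicBall {p : ℕ} [Fact p.Prime] (a : ℤ_[p]) (n : ℕ) : Set ℤ_[p] :=
  {x | ∃ z : ℤ_[p], x = a + (p : ℤ_[p]) ^ n * z}

/-- The forward orbit of `x` under `f`. -/
def forwardOrbit {α : Type*} (f : α → α) (x : α) : Set α :=
  Set.range fun n : ℕ => f^[n] x

/-- `f` leaves the nonempty set `S` invariant and the subsystem `f : S → S` is minimal: every
orbit that starts in `S` is dense in `S`. -/
def IsMinimalOn {α : Type*} [TopologicalSpace α] (f : α → α) (S : Set α) : Prop :=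
  S.Nonempty ∧ MapsTo f S S ∧ ∀ x ∈ S, S ⊆ closure (forwardOrbit f x)

/-- The points whose orbit approaches `A`: `dist (fⁿ x, A) → 0`.
(The extended distance to the empty set is `⊤`, so nothing is attracted to the empty set.) -/
def attractingBasin {α : Type*} [PseudoEMetricSpace α] (f : α → α) (A : Set α) : Set α :=
  {x | Tendsto (fun n : ℕ => Metric.infEDist (f^[n] x) A) atTop (𝓝 0)}

/-- A minimal component of `f : ℤ_p → ℤ_p`: a clopen invariant set that is a finite union of
balls and on which `f` is minimal. -/
def IsMinimalComponent {p : ℕ} [Fact p.Prime] (f : ℤ_[p] → ℤ_[p]) (S : Set ℤ_[p]) : Prop :=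
  IsClopen S ∧
  (∃ s : Finset (ℤ_[p] × ℕ), S = ⋃ c ∈ s, padicBall c.1 c.2) ∧
  IsMinimalOn f S

/-- `ℤ_p`, the disjoint union of `P`, all `M i` and `B`, is the minimal decomposition of `ℤ_p` for `f`. -/
structure IsMinimalDecomposition {p : ℕ} [Fact p.Prime] (f : ℤ_[p] → ℤ_[p])
    (P : Set ℤ_[p]) {ι : Type*} (M : ι → Set ℤ_[p]) (B : Set ℤ_[p]) : Prop where
  /-- The three parts cover `ℤ_p`. -/
  cover : P ∪ (⋃ i, M i) ∪ B = Set.univ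
  disjoint_PM : Disjoint P (⋃ i, M i)
  disjoint_PB : Disjoint P B
  disjoint_MB : Disjoint (⋃ i, M i) B
  /-- `P` is the set of all periodic points, and it is finite. -/
  periodic : P = Function.periodicPts f
  finite_periodic : P.Finite
  /-- The sets `M i` are pairwise disjoint, at most countably many, and they are exactly all
  the minimal components of `f`. -/
  disjoint_M : Pairwise (Disjoint on M)
  countable_M : (Set.range M).Countable
  component_iff : ∀ S : Set ℤ_[p], IsMinimalComponent f S ↔ ∃ i, S = M i
  /-- Each point of `B` is attracted to a periodic orbit or to a minimal component. -/
  basin : ∀ x ∈ B, (∃ y ∈ P, x ∈ attractingBasin f (forwardOrbit f y)) ∨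
    ∃ i, x ∈ attractingBasin f (M i)

/-! Write S for `chebSeq`. Then F_{2n}(x) = x S_n(x² + 2), and for q odd, m = 2n with n = 2^(t+2) u
+ 1, u odd (`exists_odd_eq_two_pow_digitRepeat`). For even x the argument of S is 2 mod 4, and
doubling formulas give S_n - 1 valuation exactly t + 2 (`chebSeq_sub_one`). So F moves an even x by
x · 2^(t+2) · (odd), while its difference quotients are 1 mod 4. These two facts form `ExpandsEven`
with s = t + 2. They pass to the 2^j-th iterate with s + j, so that iterate flips exactly the next
binary digit on each M_{n,k}; this gives minimality (`ExpandsEven.isMinimalOn`). Odd points become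
even after one step because 3 divides m. -/

/-- The sequence `S₀ = 0`, `S₁ = 1`, `S_{n+2} = y S_{n+1} - S_n` (Chebyshev polynomials of the
second kind, rescaled). -/
def chebSeq {R : Type*} [CommRing R] (y : R) : ℕ → R
  | 0 => 0
  | 1 => 1
  | n + 2 => y * chebSeq y (n + 1) - chebSeq y n

/-! ### Chebyshev recursion and 2-divisibility of Fibonacci polynomial values -/

section Cheb

variable {R : Type*} [CommRing R]

lemma chebSeq_add_two (y : R) (n : ℕ) :
    chebSeq y (n + 2) = y * chebSeq y (n + 1) - chebSeq y n := rfl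

lemma chebSeq_invariant (y : R) (n : ℕ) :
    chebSeq y (n + 1) ^ 2 - y * chebSeq y (n + 1) * chebSeq y n + chebSeq y n ^ 2 = 1 := by
  induction n with
  | zero => simp [chebSeq]
  | succ n ih => rw [chebSeq_add_two]; linear_combination ih

lemma chebSeq_double (y : R) (n : ℕ) :
    chebSeq y (2 * n) = chebSeq y n * (2 * chebSeq y (n + 1) - y * chebSeq y n) ∧
    chebSeq y (2 * n + 1) = chebSeq y (n + 1) ^ 2 - chebSeq y n ^ 2 := by
  induction n with
  | zero => simp [chebSeq]
  | succ n ih =>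
    obtain ⟨h1, h2⟩ := ih
    have h3 : chebSeq y (2 * (n + 1)) = y * chebSeq y (2 * n + 1) - chebSeq y (2 * n) := rfl
    have h4 : chebSeq y (2 * (n + 1) + 1) =
      y * chebSeq y (2 * (n + 1)) - chebSeq y (2 * n + 1) := rfl
    rw [h4, h3, h1, h2, chebSeq_add_two]
    constructor <;> ring

lemma chebSeq_double_add_one_sub_one (y : R) (n : ℕ) :
    chebSeq y (2 * n + 1) - 1 =
      chebSeq y n * (y * chebSeq y (n + 1) - 2 * chebSeq y n) := by
  rw [(chebSeq_double y n).2]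
  linear_combination chebSeq_invariant y n

lemma chebSeq_modFour (z : R) (n : ℕ) :
    (∃ c, chebSeq (2 + 4 * z) n = n + 4 * c) ∧
    ∃ c, chebSeq (2 + 4 * z) (n + 1) = n + 1 + 4 * c := by
  induction n with
  | zero => exact ⟨⟨0, by simp [chebSeq]⟩, ⟨0, by simp [chebSeq]⟩⟩
  | succ n ih =>
    obtain ⟨⟨a, ha⟩, ⟨b, hb⟩⟩ := ih
    refine ⟨⟨b, by rw [hb]; push_cast; ring⟩, ⟨2 * b + z * (n + 1 + 4 * b) - a, ?_⟩⟩
    rw [chebSeq_add_two, ha, hb]; push_cast; ring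

/-- Each doubling of the index contributes one factor 2: the cofactor in `chebSeq_double` is twice
an odd element, by the congruence S_n ≡ n mod 4. -/
lemma chebSeq_two_pow_mul (z : R) {u : ℕ} (hu : Odd u) (j : ℕ) :
    ∃ c, chebSeq (2 + 4 * z) (2 ^ j * u) = 2 ^ j * (1 + 2 * c) := by
  induction j with
  | zero =>
    obtain ⟨⟨a, ha⟩, -⟩ := chebSeq_modFour z u
    obtain ⟨v, rfl⟩ := hu
    exact ⟨v + 2 * a, by simp only [pow_zero, one_mul]; rw [ha]; push_cast; ring⟩
  | succ j ih =>
    obtain ⟨c, hc⟩ := ih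
    obtain ⟨⟨a, ha⟩, ⟨b, hb⟩⟩ := chebSeq_modFour z (2 ^ j * u)
    have e : 2 ^ (j + 1) * u = 2 * (2 ^ j * u) := by ring
    set r := 2 ^ j * u
    have h : 2 * chebSeq (2 + 4 * z) (r + 1) - (2 + 4 * z) * chebSeq (2 + 4 * z) r
        = 2 * (1 + 2 * (2 * b - 2 * a - z * (r + 4 * a))) := by
      rw [ha, hb]; ring
    refine ⟨c + (1 + 2 * c) * (2 * b - 2 * a - z * (r + 4 * a)), ?_⟩
    rw [e, (chebSeq_double _ r).1, h, hc]; ring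

lemma chebSeq_sub_one (z : R) {u : ℕ} (hu : Odd u) (j : ℕ) :
    ∃ c, chebSeq (2 + 4 * z) (2 ^ (j + 1) * u + 1) - 1 = 2 ^ (j + 1) * (1 + 2 * c) := by
  obtain ⟨c, hc⟩ := chebSeq_two_pow_mul z hu j
  obtain ⟨⟨a, ha⟩, ⟨b, hb⟩⟩ := chebSeq_modFour z (2 ^ j * u)
  have e : 2 ^ (j + 1) * u = 2 * (2 ^ j * u) := by ring
  set r := 2 ^ j * u
  have h : (2 + 4 * z) * chebSeq (2 + 4 * z) (r + 1) - 2 * chebSeq (2 + 4 * z) r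
      = 2 * (1 + 2 * (2 * b - 2 * a + z * (r + 1 + 4 * b))) := by
    rw [ha, hb]; ring
  refine ⟨c + (1 + 2 * c) * (2 * b - 2 * a + z * (r + 1 + 4 * b)), ?_⟩
  rw [e, chebSeq_double_add_one_sub_one, h, hc]; ring

lemma fibPoly_eval_add_two (x : R) (m : ℕ) :
    (fibPoly R (m + 2)).eval x = x * (fibPoly R (m + 1)).eval x + (fibPoly R m).eval x := by
  simp [fibPoly]

lemma fibPoly_eval_add_four (x : R) (m : ℕ) :
    (fibPoly R (m + 4)).eval x =
      (x ^ 2 + 2) * (fibPoly R (m + 2)).eval x - (fibPoly R m).eval x := by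
  rw [fibPoly_eval_add_two x (m + 2), fibPoly_eval_add_two x (m + 1), fibPoly_eval_add_two x m]
  ring

lemma fibPoly_eval_two_mul (x : R) (n : ℕ) :
    (fibPoly R (2 * n)).eval x = x * chebSeq (x ^ 2 + 2) n ∧
    (fibPoly R (2 * (n + 1))).eval x = x * chebSeq (x ^ 2 + 2) (n + 1) := by
  induction n with
  | zero => simp [fibPoly, chebSeq]
  | succ n ih =>
    refine ⟨ih.2, ?_⟩
    have e : 2 * (n + 1 + 1) = 2 * n + 4 := by ring
    have e' : 2 * n + 2 = 2 * (n + 1) := by ring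
    rw [e, fibPoly_eval_add_four, e', ih.1, ih.2, chebSeq_add_two]; ring

lemma fibPoly_eval_sub_self {x : R} (hx : 2 ∣ x) {u : ℕ} (hu : Odd u) (j : ℕ) :
    ∃ c, (fibPoly R (2 * (2 ^ (j + 1) * u + 1))).eval x - x =
      x * 2 ^ (j + 1) * (1 + 2 * c) := by
  obtain ⟨z, rfl⟩ := hx
  obtain ⟨c, hc⟩ := chebSeq_sub_one (z ^ 2) hu j
  refine ⟨c, ?_⟩
  have e : (2 * z) ^ 2 + 2 = 2 + 4 * z ^ 2 := by ring
  rw [(fibPoly_eval_two_mul _ _).1, e]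
  linear_combination (2 * z) * hc

/-- On even arguments, `F_{2n}` has difference quotients congruent to `n` modulo `4`. -/
lemma fibPoly_eval_sub (a b : R) (n : ℕ) :
    (∃ c, (fibPoly R (2 * n)).eval (2 * a) - (fibPoly R (2 * n)).eval (2 * b) =
      (2 * a - 2 * b) * (n + 4 * c)) ∧
    ∃ c, (fibPoly R (2 * (n + 1))).eval (2 * a) - (fibPoly R (2 * (n + 1))).eval (2 * b) =
      (2 * a - 2 * b) * (n + 1 + 4 * c) := by
  induction n with
  | zero => exact ⟨⟨0, by simp [fibPoly]⟩, ⟨0, by simp [fibPoly]⟩⟩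
  | succ n ih =>
    obtain ⟨⟨c, hc⟩, ⟨d, hd⟩⟩ := ih
    refine ⟨⟨d, by rw [hd]; push_cast; ring⟩, ?_⟩
    have e : 2 * (n + 1 + 1) = 2 * n + 4 := by ring
    have e' : 2 * n + 2 = 2 * (n + 1) := by ring
    have hb := (fibPoly_eval_two_mul (2 * b) n).2
    rw [e, fibPoly_eval_add_four, fibPoly_eval_add_four, e']
    -- The last summand is ((2a)² - (2b)²) F_{2n+2}(2b): one factor 2 beyond 2a - 2b comes from the
    -- difference of squares, another from F_{2n+2}(2b) = 2b S_{n+1}.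
    refine ⟨2 * d - c + a ^ 2 * (n + 1 + 4 * d) +
      (a + b) * b * chebSeq ((2 * b) ^ 2 + 2) (n + 1), ?_⟩
    push_cast
    linear_combination ((2 * a) ^ 2 + 2) * hd - hc + ((2 * a) ^ 2 - (2 * b) ^ 2) * hb

/-- `F_{3k}` takes even values at odd arguments. -/
lemma two_dvd_fibPoly_eval (w : R) (k : ℕ) : 2 ∣ (fibPoly R (3 * k)).eval (1 + 2 * w) := by
  induction k with
  | zero => simp [fibPoly]
  | succ k ih =>
    obtain ⟨c, hc⟩ := ih
    have e : 3 * (k + 1) = 3 * k + 1 + 2 := by ring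
    rw [e, fibPoly_eval_add_two, fibPoly_eval_add_two, hc]
    exact ⟨(1 + 2 * w + 2 * w ^ 2) * (fibPoly R (3 * k + 1)).eval (1 + 2 * w)
      + (1 + 2 * w) * c, by ring⟩

end Cheb

/-! ### Binary digits of q -/

lemma digitRepeat_eq_zero {q : ℕ} (h : q.testBit 0 = q.testBit 1) : digitRepeat q = 0 :=
  Nat.le_zero.1 (Nat.sInf_le h)

lemma digitRepeat_eq_succ {q : ℕ} (h : q.testBit 0 ≠ q.testBit 1) :
    digitRepeat q = digitRepeat (q / 2) + 1 := by
  have hne : {i : ℕ | q.testBit i = q.testBit (i + 1)}.Nonempty := by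
    refine ⟨q, ?_⟩
    have h1 : q < 2 ^ q := Nat.lt_two_pow_self
    have h2 : q < 2 ^ (q + 1) := h1.trans (Nat.pow_lt_pow_right (by norm_num) (by omega))
    simp [Nat.testBit_lt_two_pow h1, Nat.testBit_lt_two_pow h2]
  have h0 : 0 < sInf {i : ℕ | q.testBit i = q.testBit (i + 1)} := by
    refine Nat.pos_of_ne_zero fun h0 => h ?_
    have := Nat.sInf_mem hne
    rwa [h0] at this
  have := Nat.sInf_add (p := fun i => q.testBit i = q.testBit (i + 1)) (n := 1) h0
  rw [digitRepeat, digitRepeat, ← this]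
  simp only [Nat.testBit_add_one]

/-- `2 + 3q` (for even `q`) and `1 + 3q` (for odd `q`) have `2`-adic valuation `t(q) + 1`. -/
lemma exists_odd_eq_two_pow_digitRepeat (q : ℕ) :
    ∃ u, Odd u ∧ 2 - q % 2 + 3 * q = 2 ^ (digitRepeat q + 1) * u := by
  induction q using Nat.strong_induction_on with
  | _ q ih =>
    by_cases h : q.testBit 0 = q.testBit 1
    · rw [digitRepeat_eq_zero h]
      have h' : q % 2 = q / 2 % 2 := by
        simp only [Nat.testBit_succ, Nat.testBit_zero, decide_eq_decide] at h
        omega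
      refine ⟨(2 - q % 2 + 3 * q) / 2, ?_, ?_⟩
      · rw [Nat.odd_iff]; omega
      · omega
    -- When the two lowest digits differ, the expression for q is twice the one for q / 2; when they
    -- agree, it is 2 mod 4.
    · rw [digitRepeat_eq_succ h]
      have h' : q % 2 ≠ q / 2 % 2 := by
        simp only [Nat.testBit_succ, Nat.testBit_zero, decide_eq_decide] at h
        omega
      obtain ⟨u, hu, e⟩ := ih (q / 2) (by omega)
      refine ⟨u, hu, ?_⟩
      rw [pow_succ, mul_assoc, mul_comm 2 u, ← mul_assoc, ← e]
      omega

/-! ### Balls, orbits and basins -/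

section PadicBall

variable {p : ℕ} [Fact p.Prime]

lemma mem_padicBall_iff {a x : ℤ_[p]} {n : ℕ} : x ∈ padicBall a n ↔ (p : ℤ_[p]) ^ n ∣ x - a :=
  ⟨fun ⟨z, hz⟩ => ⟨z, by rw [hz]; ring⟩, fun ⟨z, hz⟩ => ⟨z, by rw [← hz]; ring⟩⟩

lemma padicBall_eq_closedBall (a : ℤ_[p]) (n : ℕ) :
    padicBall a n = Metric.closedBall a ((p : ℝ) ^ (-n : ℤ)) := by
  ext x
  rw [mem_padicBall_iff, Metric.mem_closedBall, dist_eq_norm, PadicInt.norm_le_pow_iff_mem_span_pow,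
    Ideal.mem_span_singleton]

lemma isClopen_padicBall (a : ℤ_[p]) (n : ℕ) : IsClopen (padicBall a n) := by
  rw [padicBall_eq_closedBall]
  refine IsUltrametricDist.isClopen_closedBall a ?_
  have : (p : ℝ) ≠ 0 := by exact_mod_cast (Fact.out : p.Prime).ne_zero
  positivity

lemma mem_closure_of_dvd {s : Set ℤ_[p]} {x : ℤ_[p]}
    (h : ∀ n : ℕ, ∃ y ∈ s, (p : ℤ_[p]) ^ n ∣ x - y) : x ∈ closure s := by
  rw [Metric.mem_closure_iff]
  intro ε hε
  obtain ⟨n, hn⟩ := PadicInt.exists_pow_neg_lt p hε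
  obtain ⟨y, hy, hd⟩ := h n
  refine ⟨y, hy, lt_of_le_of_lt ?_ hn⟩
  rw [dist_eq_norm, PadicInt.norm_le_pow_iff_mem_span_pow, Ideal.mem_span_singleton]
  exact hd

lemma infinite_padicBall (a : ℤ_[p]) (n : ℕ) : (padicBall a n).Infinite := by
  have : padicBall a n = Set.range fun z : ℤ_[p] => a + (p : ℤ_[p]) ^ n * z := by
    ext x; exact ⟨fun ⟨z, hz⟩ => ⟨z, hz.symm⟩, fun ⟨z, hz⟩ => ⟨z, hz.symm⟩⟩
  rw [this]
  refine Set.infinite_range_of_injective fun x y h => ?_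
  have hp : (p : ℤ_[p]) ^ n ≠ 0 := pow_ne_zero _ PadicInt.prime_p.ne_zero
  exact mul_left_cancel₀ hp (add_left_cancel h)

/-- A nonempty open set of `p`-adic integers is infinite. -/
lemma infinite_of_isOpen {s : Set ℤ_[p]} (hs : IsOpen s) (hne : s.Nonempty) : s.Infinite := by
  obtain ⟨x, hx⟩ := hne
  obtain ⟨ε, hε, h⟩ := Metric.isOpen_iff.1 hs x hx
  obtain ⟨n, hn⟩ := PadicInt.exists_pow_neg_lt p hε
  refine (infinite_padicBall x n).mono fun y hy => h ?_
  rw [padicBall_eq_closedBall] at hy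
  exact lt_of_le_of_lt hy hn

lemma mem_attractingBasin_of_apply_mem {α : Type*} [PseudoEMetricSpace α] {f : α → α} {A : Set α}
    (hA : MapsTo f A A) {x : α} (hx : f x ∈ A) : x ∈ attractingBasin f A := by
  refine tendsto_const_nhds.congr' ?_
  filter_upwards [eventually_ge_atTop 1] with n hn
  obtain ⟨k, rfl⟩ := Nat.exists_eq_add_of_le' hn
  refine (Metric.infEDist_zero_of_mem ?_).symm
  rw [iterate_succ_apply]
  exact hA.iterate k hx

lemma forwardOrbit_subset {α : Type*} {f : α → α} {A : Set α} (hA : MapsTo f A A) {x : α}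
    (hx : x ∈ A) : forwardOrbit f x ⊆ A := by
  rintro _ ⟨n, rfl⟩
  exact hA.iterate n hx

lemma finite_forwardOrbit_of_periodic {α : Type*} {f : α → α} {x : α}
    (hx : x ∈ Function.periodicPts f) : (forwardOrbit f x).Finite := by
  obtain ⟨n, hn, h⟩ := hx
  refine ((Set.finite_lt_nat n).image fun k => f^[k] x).subset ?_
  rintro _ ⟨k, rfl⟩
  exact ⟨k % n, Nat.mod_lt k hn, h.iterate_mod_apply k⟩

end PadicBall

/-! ### Dynamics on the even 2-adic integers -/

section TwoAdic

lemma even_or_odd_padicInt (x : ℤ_[2]) : (∃ c, x = 2 * c) ∨ ∃ c, x = 1 + 2 * c := by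
  obtain ⟨n, hn, h⟩ := PadicInt.exists_mem_range x
  rw [PadicInt.maximalIdeal_eq_span_p, Ideal.mem_span_singleton] at h
  obtain ⟨c, hc⟩ := h
  push_cast at hc
  interval_cases n
  · exact Or.inl ⟨c, by simpa using hc⟩
  · exact Or.inr ⟨c, by linear_combination hc⟩

lemma not_two_dvd_one_add (c : ℤ_[2]) : ¬ (2 : ℤ_[2]) ∣ 1 + 2 * c := by
  intro h
  have h1 : (2 : ℤ_[2]) ∣ 1 := by
    have := dvd_sub h (Dvd.intro c rfl)
    simpa using this
  have h2 : Prime (2 : ℤ_[2]) := by exact_mod_cast PadicInt.prime_p (p := 2)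
  exact h2.not_dvd_one h1

/-- Hypotheses on `f` that describe its behaviour on the even `2`-adic integers. -/
structure ExpandsEven (f : ℤ_[2] → ℤ_[2]) (s : ℕ) : Prop where
  sub_self : ∀ a, ∃ c, f (2 * a) - 2 * a = 2 * a * 2 ^ s * (1 + 2 * c)
  sub : ∀ a b, ∃ c, f (2 * a) - f (2 * b) = (2 * a - 2 * b) * (1 + 4 * c)

variable {f : ℤ_[2] → ℤ_[2]} {s : ℕ}

/-- The property passes to the second iterate, with `s` replaced by `s + 1`. -/
lemma ExpandsEven.comp_self (h : ExpandsEven f s) : ExpandsEven (f ∘ f) (s + 1) := by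
  have key : ∀ a, ∃ b, f (2 * a) = 2 * b := fun a => by
    obtain ⟨c, hc⟩ := h.sub_self a
    exact ⟨a + a * 2 ^ s * (1 + 2 * c), by linear_combination hc⟩
  constructor
  · intro a
    obtain ⟨b, hb⟩ := key a
    obtain ⟨c, hc⟩ := h.sub_self a
    obtain ⟨d, hd⟩ := h.sub b a
    -- With x = 2a: f(f x) - x = (f x - x)(1 + 4d) + (f x - x) = (f x - x) · 2(1 + 2d).
    refine ⟨c + d + 2 * c * d, ?_⟩
    simp only [comp_apply]
    rw [hb] at hc hd ⊢
    rw [pow_succ]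
    linear_combination hd + (2 + 4 * d) * hc
  · intro a b
    obtain ⟨a', ha⟩ := key a
    obtain ⟨b', hb⟩ := key b
    obtain ⟨c, hc⟩ := h.sub a b
    obtain ⟨d, hd⟩ := h.sub a' b'
    refine ⟨c + d + 4 * c * d, ?_⟩
    simp only [comp_apply]
    rw [ha, hb] at hc ⊢
    linear_combination hd + (1 + 4 * d) * hc

lemma ExpandsEven.iterate_two_pow (h : ExpandsEven f s) (j : ℕ) :
    ExpandsEven (f^[2 ^ j]) (s + j) := by
  induction j with
  | zero => simpa using h
  | succ j ih =>
    have := ih.comp_self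
    rwa [← iterate_add, ← two_mul, ← pow_succ'] at this

lemma ExpandsEven.mapsTo_padicBall (h : ExpandsEven f s) {a : ℤ_[2]} {N : ℕ} (hN : 1 ≤ N)
    (ha : (2 : ℤ_[2]) ^ N ∣ a) : MapsTo f (padicBall a (N + s)) (padicBall a (N + s)) := by
  rintro x hx
  rw [mem_padicBall_iff] at hx ⊢
  push_cast at hx ⊢
  have hxN : (2 : ℤ_[2]) ^ N ∣ x := by
    simpa using dvd_add ((pow_dvd_pow 2 (Nat.le_add_right N s)).trans hx) ha
  obtain ⟨w, hw⟩ := (pow_dvd_pow (2 : ℤ_[2]) hN).trans hxN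
  rw [pow_one] at hw
  obtain ⟨c, hc⟩ := h.sub_self w
  rw [← hw] at hc
  obtain ⟨z, hz⟩ := hxN
  have e : f x - a = (f x - x) + (x - a) := by ring
  rw [e]
  refine dvd_add ⟨z * (1 + 2 * c), ?_⟩ hx
  rw [hc, pow_add]
  nth_rw 1 [hz]
  ring

lemma ExpandsEven.isMinimalOn (h : ExpandsEven f s) (hs : 1 ≤ s) {N : ℕ} (hN : 1 ≤ N)
    (v : ℤ_[2]) :
    IsMinimalOn f (padicBall ((1 + 2 * v) * 2 ^ N) (N + s)) := by
  have hmaps := h.mapsTo_padicBall hN (Dvd.intro_left (1 + 2 * v) rfl : (2 : ℤ_[2]) ^ N ∣ _)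
  refine ⟨⟨(1 + 2 * v) * 2 ^ N, 0, by simp⟩, hmaps, fun x hx z hz => ?_⟩
  suffices hj : ∀ j : ℕ, ∃ k : ℕ, (2 : ℤ_[2]) ^ (N + s + j) ∣ z - f^[k] x by
    refine mem_closure_of_dvd fun j => ?_
    obtain ⟨k, hk⟩ := hj j
    exact ⟨_, ⟨k, rfl⟩, by push_cast; exact (pow_dvd_pow 2 (by omega)).trans hk⟩
  intro j
  induction j with
  | zero =>
    refine ⟨0, ?_⟩
    rw [mem_padicBall_iff] at hx hz
    push_cast at hx hz
    have := dvd_sub hz hx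
    simpa using this
  | succ j ih =>
    obtain ⟨k, d, hd⟩ := ih
    rcases even_or_odd_padicInt d with ⟨c, rfl⟩ | ⟨c, rfl⟩
    · exact ⟨k, c, by rw [hd]; ring⟩
    -- Here the orbit point misses z at digit N + s + j. Since it has valuation N, a further 2^j
    -- steps move it by 2^(N+s+j) times an odd number and correct that digit.
    · obtain ⟨y, hy⟩ := hmaps.iterate k hx
      push_cast at hy
      obtain ⟨r, rfl⟩ := Nat.exists_eq_add_of_le' hs
      obtain ⟨M, rfl⟩ := Nat.exists_eq_add_of_le' hN
      have hy' : f^[k] x = 2 * (2 ^ M * (1 + 2 * (v + 2 ^ r * y))) := by rw [hy]; ring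
      obtain ⟨e, he⟩ := (h.iterate_two_pow j).sub_self (2 ^ M * (1 + 2 * (v + 2 ^ r * y)))
      rw [← hy', ← iterate_add_apply, hy'] at he
      rw [hy'] at hd
      refine ⟨2 ^ j + k, c - (v + 2 ^ r * y + e + 2 * (v + 2 ^ r * y) * e), ?_⟩
      have e1 : (2 : ℤ_[2]) ^ (M + 1 + (r + 1) + (j + 1)) = 2 ^ (M + 1 + (r + 1) + j) * 2 :=
        pow_succ _ _
      have e2 : (2 : ℤ_[2]) * 2 ^ M * 2 ^ (r + 1 + j) = 2 ^ (M + 1 + (r + 1) + j) := by ring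
      rw [e1]
      linear_combination hd - he - (1 + 2 * (v + 2 ^ r * y)) * (1 + 2 * e) * e2

/-- Every nonzero even `2`-adic integer lies in one of the balls `(1 + 2k) 2^N + 2^(N+t+2) ℤ₂`. -/
lemma exists_mem_padicBall {x : ℤ_[2]} (hx : x ≠ 0) (h2 : (2 : ℤ_[2]) ∣ x) (t : ℕ) :
    ∃ i : ℕ+ × Fin (2 ^ (t + 1)),
      x ∈ padicBall ((1 + 2 * ((i.2 : ℕ) : ℤ_[2])) * 2 ^ (i.1 : ℕ)) ((i.1 : ℕ) + t + 2) := by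
  have hu := PadicInt.unitCoeff_spec hx
  set u := PadicInt.unitCoeff hx
  set N := x.valuation
  push_cast at hu
  have hodd : ∃ c, (u : ℤ_[2]) = 1 + 2 * c := by
    refine (even_or_odd_padicInt _).resolve_left ?_
    rintro ⟨c, hc⟩
    have h2u : IsUnit (2 : ℤ_[2]) := isUnit_of_dvd_unit (Dvd.intro c hc.symm) u.isUnit
    exact not_two_dvd_one_add 0 (by simpa using h2u.dvd)
  obtain ⟨c, hc⟩ := hodd
  have hN : 0 < N := by
    refine Nat.pos_of_ne_zero fun h0 => not_two_dvd_one_add c ?_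
    rwa [hu, h0, pow_zero, mul_one, hc] at h2
  -- The index k is the odd part's c truncated modulo 2^(t+1).
  have hk := PadicInt.appr_spec (t + 1) c
  rw [Ideal.mem_span_singleton] at hk
  obtain ⟨d, hd⟩ := hk
  push_cast at hd
  refine ⟨(⟨N, hN⟩, ⟨c.appr (t + 1), c.appr_lt (t + 1)⟩), d, ?_⟩
  rw [hu, hc]
  simp only [PNat.mk_coe]
  push_cast
  rw [show N + t + 2 = N + (t + 1) + 1 by ring, pow_succ, pow_add]
  linear_combination 2 * 2 ^ N * hd

lemma pow_mul_odd_injective {a b : ℤ_[2]} {m n : ℕ}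
    (h : (1 + 2 * a) * 2 ^ m = (1 + 2 * b) * 2 ^ n) : m = n ∧ a = b := by
  have key : ∀ {a b : ℤ_[2]} {m n : ℕ}, (1 + 2 * a) * 2 ^ m = (1 + 2 * b) * 2 ^ n → n ≤ m := by
    intro a b m n h
    by_contra hlt
    obtain ⟨k, rfl⟩ := Nat.exists_eq_add_of_lt (not_le.1 hlt)
    refine not_two_dvd_one_add a ⟨(1 + 2 * b) * 2 ^ k, ?_⟩
    have h2 : (2 : ℤ_[2]) ^ m ≠ 0 := pow_ne_zero _ two_ne_zero
    refine mul_right_cancel₀ h2 ?_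
    rw [h]; ring
  obtain rfl := le_antisymm (key h.symm) (key h)
  refine ⟨rfl, ?_⟩
  have h2 : (2 : ℤ_[2]) ^ m ≠ 0 := pow_ne_zero _ two_ne_zero
  exact mul_left_cancel₀ two_ne_zero (add_left_cancel (mul_right_cancel₀ h2 h))

/-- The valuation of x determines N, and its odd part determines k modulo 2^(t+1), hence k. -/
lemma eq_of_mem_padicBall {t : ℕ} {i j : ℕ+ × Fin (2 ^ (t + 1))} {x : ℤ_[2]}
    (hi : x ∈ padicBall ((1 + 2 * ((i.2 : ℕ) : ℤ_[2])) * 2 ^ (i.1 : ℕ)) ((i.1 : ℕ) + t + 2))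
    (hj : x ∈ padicBall ((1 + 2 * ((j.2 : ℕ) : ℤ_[2])) * 2 ^ (j.1 : ℕ)) ((j.1 : ℕ) + t + 2)) :
    i = j := by
  obtain ⟨N, k, hk⟩ := i
  obtain ⟨N', k', hk'⟩ := j
  obtain ⟨y, hy⟩ := hi
  obtain ⟨z, hz⟩ := hj
  have h : (1 + 2 * ((k : ℤ_[2]) + 2 ^ (t + 1) * y)) * 2 ^ (N : ℕ) =
      (1 + 2 * ((k' : ℤ_[2]) + 2 ^ (t + 1) * z)) * 2 ^ (N' : ℕ) := by
    push_cast at hy hz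
    have e := hy.symm.trans hz
    simp only [pow_add] at e ⊢
    linear_combination e
  obtain ⟨hN, h'⟩ := pow_mul_odd_injective h
  have hd : ((2 : ℕ) : ℤ_[2]) ^ (t + 1) ∣ (((k : ℤ) - (k' : ℤ) : ℤ) : ℤ_[2]) :=
    ⟨z - y, by push_cast; linear_combination h'⟩
  rw [PadicInt.pow_p_dvd_int_iff] at hd
  have hlt : |(k : ℤ) - k'| < ((2 : ℕ) : ℤ) ^ (t + 1) := by
    zify at hk hk'
    push_cast
    rw [abs_lt]
    constructor <;> linarith
  have hkk : k = k' := by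
    have := Int.eq_zero_of_abs_lt_dvd hd hlt
    omega
  obtain rfl := PNat.coe_injective hN
  subst hkk
  rfl

end TwoAdic

/-! ### The minimal decomposition -/

theorem mainTheorem7 (m q t : ℕ) (hq : Odd q) (hm : m = 6 + 12 * q) (ht : t = digitRepeat q)
    (F : ℤ_[2] → ℤ_[2]) (hF : F = fun x => (fibPoly ℤ_[2] m).eval x)
    (M : ℕ+ × Fin (2 ^ (t + 1)) → Set ℤ_[2])
    (hM : M = fun i => padicBall ((1 + 2 * ((i.2 : ℕ) : ℤ_[2])) * 2 ^ (i.1 : ℕ))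
      ((i.1 : ℕ) + t + 2)) :
    IsMinimalDecomposition F {0} M (padicBall 1 1) ∧
    F 0 = 0 ∧
    padicBall 1 1 =
      (attractingBasin F {0} ∪ ⋃ i, attractingBasin F (M i)) \ ({0} ∪ ⋃ i, M i) := by
  obtain ⟨u, hu, e⟩ := exists_odd_eq_two_pow_digitRepeat q
  rw [← ht] at e
  have hm' : m = 2 * (2 ^ (t + 1 + 1) * u + 1) := by
    rw [pow_succ, mul_assoc, mul_comm 2 u, ← mul_assoc, ← e, Nat.odd_iff.1 hq]
    omega
  have hexp : ExpandsEven F (t + 2) := by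
    constructor
    · intro a
      rw [hF, hm']
      exact fibPoly_eval_sub_self (Dvd.intro a rfl) hu (t + 1)
    · intro a b
      rw [hF, hm']
      obtain ⟨⟨c, hc⟩, -⟩ := fibPoly_eval_sub a b (2 ^ (t + 1 + 1) * u + 1)
      -- Half the index is 1 + 4 · 2^t u, hence 1 mod 4.
      exact ⟨2 ^ t * u + c, by rw [hc]; push_cast; ring⟩
  have hF0 : F 0 = 0 := by
    obtain ⟨c, hc⟩ := hexp.sub_self 0
    simpa using hc
  have hodd : ∀ x ∈ padicBall (1 : ℤ_[2]) 1, 2 ∣ F x := by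
    rintro x ⟨w, rfl⟩
    rw [hF, hm, show 6 + 12 * q = 3 * (2 + 4 * q) by ring]
    simpa using two_dvd_fibPoly_eval w (2 + 4 * q)
  have hmin : ∀ i, IsMinimalOn F (M i) := by
    intro i
    rw [hM]
    exact hexp.isMinimalOn (by omega) i.1.pos _
  have hclopen : ∀ i, IsClopen (M i) := fun i => by rw [hM]; exact isClopen_padicBall _ _
  have hmem : ∀ x : ℤ_[2], x ≠ 0 → 2 ∣ x → ∃ i, x ∈ M i := by
    intro x hx h2
    rw [hM]
    exact exists_mem_padicBall hx h2 t
  have hMeven : ∀ i, ∀ x ∈ M i, (2 : ℤ_[2]) ∣ x := by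
    intro i x hx
    rw [hM] at hx
    obtain ⟨z, rfl⟩ := hx
    have hp : (2 : ℤ_[2]) ∣ 2 ^ (i.1 : ℕ) := dvd_pow_self 2 i.1.ne_zero
    refine dvd_add (hp.mul_left _) (Dvd.dvd.mul_right ?_ _)
    push_cast
    exact dvd_pow_self 2 (by omega)
  have hball : ∀ x : ℤ_[2], x ∈ padicBall (1 : ℤ_[2]) 1 ↔ ¬ 2 ∣ x := by
    intro x
    constructor
    · rintro ⟨z, rfl⟩
      simpa using not_two_dvd_one_add z
    · intro h
      obtain ⟨c, hc⟩ := (even_or_odd_padicInt x).resolve_left fun ⟨c, hc⟩ => h ⟨c, hc⟩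
      exact ⟨c, by simpa using hc⟩
  have horbit0 : forwardOrbit F 0 = {0} := by
    ext y
    simp [forwardOrbit, iterate_fixed hF0]
  have hM0 : ∀ i, (0 : ℤ_[2]) ∉ M i := by
    intro i h0
    -- A finite orbit cannot be dense in a nonempty open set, which is infinite; the same argument
    -- excludes nonzero periodic points below.
    have h := (hmin i).2.2 0 h0
    rw [horbit0, closure_singleton] at h
    exact infinite_of_isOpen (hclopen i).isOpen ⟨0, h0⟩ ((Set.finite_singleton 0).subset h)
  have hmaps0 : MapsTo F {0} {0} := by rintro x rfl; exact hF0
  have hbasin : ∀ x ∈ padicBall (1 : ℤ_[2]) 1,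
      x ∈ attractingBasin F {0} ∨ ∃ i, x ∈ attractingBasin F (M i) := by
    intro x hx
    by_cases h0 : F x = 0
    · exact Or.inl (mem_attractingBasin_of_apply_mem hmaps0 h0)
    · obtain ⟨i, hi⟩ := hmem _ h0 (hodd x hx)
      exact Or.inr ⟨i, mem_attractingBasin_of_apply_mem (hmin i).2.1 hi⟩
  have hcompl : padicBall (1 : ℤ_[2]) 1 = ({0} ∪ ⋃ i, M i)ᶜ := by
    ext x
    rw [hball, mem_compl_iff, not_iff_not]
    constructor
    · intro h
      by_cases h0 : x = 0
      · exact Or.inl h0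
      · exact Or.inr (mem_iUnion.2 (hmem x h0 h))
    · rintro (rfl | h)
      · exact dvd_zero _
      · obtain ⟨i, hi⟩ := mem_iUnion.1 h
        exact hMeven i x hi
  have heven : ∀ x : ℤ_[2], 2 ∣ F x := by
    intro x
    by_cases h : 2 ∣ x
    · obtain ⟨a, rfl⟩ := h
      obtain ⟨c, hc⟩ := hexp.sub_self a
      exact ⟨a + a * 2 ^ (t + 2) * (1 + 2 * c), by linear_combination hc⟩
    · exact hodd x ((hball x).2 h)
  refine ⟨⟨?_, ?_, ?_, ?_, ?_, Set.finite_singleton 0, ?_, Set.countable_range M, ?_, ?_⟩,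
    hF0, ?_⟩
  · rw [hcompl, union_compl_self]
  · simpa using hM0
  · rw [hcompl]
    exact disjoint_compl_right.mono_left subset_union_left
  · rw [hcompl]
    exact disjoint_compl_right.mono_left subset_union_right
  · ext x
    constructor
    · rintro rfl
      exact ⟨1, one_pos, hF0⟩
    · intro hx
      by_contra h0
      have h2 : 2 ∣ x := by
        obtain ⟨n, hn, h⟩ := hx
        obtain ⟨k, rfl⟩ := Nat.exists_eq_add_of_le' hn
        rw [← h.eq, iterate_succ_apply']
        exact heven _
      obtain ⟨i, hi⟩ := hmem x h0 h2
      have hfin := finite_forwardOrbit_of_periodic hx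
      have hsub := (hmin i).2.2 x hi
      rw [hfin.isClosed.closure_eq] at hsub
      exact infinite_of_isOpen (hclopen i).isOpen ⟨x, hi⟩ (hfin.subset hsub)
  · intro i j hij
    refine Set.disjoint_left.2 fun x hi hj => hij ?_
    rw [hM] at hi hj
    exact eq_of_mem_padicBall hi hj
  · intro S
    constructor
    · rintro ⟨hS, -, ⟨x, hx⟩, hSmaps, hSmin⟩
      -- Passing to F x ensures evenness even if x is odd. Once F x ≠ 0, it lies in some M i, and
      -- both S and M i equal its orbit closure.
      have hFx := hSmaps hx
      have hne : F x ≠ 0 := by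
        intro h0
        rw [h0] at hFx
        have h := hSmin 0 hFx
        rw [horbit0, closure_singleton] at h
        exact infinite_of_isOpen hS.isOpen ⟨0, hFx⟩ ((Set.finite_singleton 0).subset h)
      obtain ⟨i, hi⟩ := hmem _ hne (heven x)
      refine ⟨i, Subset.antisymm ?_ ?_⟩
      · exact (hSmin _ hFx).trans
          (closure_minimal (forwardOrbit_subset (hmin i).2.1 hi) (hclopen i).isClosed)
      · exact ((hmin i).2.2 _ hi).trans
          (closure_minimal (forwardOrbit_subset hSmaps hFx) hS.isClosed)
    · rintro ⟨i, rfl⟩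
      refine ⟨hclopen i, ⟨{((1 + 2 * ((i.2 : ℕ) : ℤ_[2])) * 2 ^ (i.1 : ℕ), (i.1 : ℕ) + t + 2)},
        ?_⟩, hmin i⟩
      rw [hM]
      simp
  · intro x hx
    rcases hbasin x hx with h | h
    · exact Or.inl ⟨0, rfl, by rwa [horbit0]⟩
    · exact Or.inr h
  · rw [← compl_compl ({0} ∪ ⋃ i, M i), ← hcompl, sdiff_compl]
    refine (inter_eq_right.2 fun x hx => ?_).symm
    rcases hbasin x hx with h | h
    · exact Or.inl h
    · exact Or.inr (mem_iUnion.2 h)
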